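/- Let $\kappa\ge 1$, $A\in\mathbb{R}^{m\times m}$, $B\in\mathbb{R}^{m\times r}$ and let $\Sigma_1,\Sigma_w\in\mathbb{R}^{m\times m}$ be positive semi-definite. Consider, for $k=1,\dots,\kappa$, the system $$x_{k+1}=Ax_k+Bu_k+w_k,\qquad s_k=\sum_{j=1}^{k}L_{k,j}'x_j+\vartheta_k,\qquad u_k=\gamma_k(s_1,\dots,s_k),$$ where $x_1\sim\mathcal N(0,\Sigma_1)$, $w_k\sim\mathcal N(0,\Sigma_w)$ and $\vartheta_k\sim\mathcal N(0,\Theta_k)$ are mutually independent and the $\gamma_k$ are Borel measurable. A linear-plus-noise signaling rule $\eta$ is an arbitrary choice of gains $L_{k,j}\in\mathbb{R}^{m\times m}$ $(1\le j\le k\le\kappa)$ and of positive semi-definite $\Theta_k\in\mathbb{R}^{m\times m}$; it is memoryless if $L_{k,j}=0$ for $j<k$. The control-free state is $x_1^o=x_1$, $x_{k+1}^o=Ax_k^o+w_k$, with second moment $\Sigma_k^o=\mathbb{E}[x_k^o(x_k^o)']$, so that $\Sigma_1^o=\Sigma_1$ and $\Sigma_{k+1}^o=A\Sigma_k^oA'+\Sigma_w$.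 Put $H_k=\mathrm{cov}\big(\mathbb{E}[x_k^o\mid s_1,\dots,s_k]\big)$, and write $M\succeq N$ if $M-N$ is positive semi-definite. (Necessity.) For every linear-plus-noise signaling rule and every control policy $\gamma$, $$\Sigma_1^o\succeq H_1\succeq O,\qquad \Sigma_k^o\succeq H_k\succeq AH_{k-1}A'\quad(1<k\le\kappa).$$ (Sufficiency.) Let $S_1,\dots,S_\kappa$ be positive semi-definite matrices with $\Sigma_1^o\succeq S_1\succeq O$ and $\Sigma_k^o\succeq S_k\succeq AS_{k-1}A'$ for $1<k\le\kappa$. Then there is a memoryless linear-plus-noise signaling rule with $H_k=S_k$ for all $k$, whatever the control policy is. Explicitly, with the convention $AS_0A'=O$: for each $k$ let $$\Sigma_k^o-AS_{k-1}A'=\bar U_k\begin{bmatrix}\bar\Lambda_k&O\\O&O\end{bmatrix}\bar U_k'$$ be an eigen-decomposition with $\bar U_k$ orthogonal and $\bar\Lambda_k$ diagonal and positive definite of size $t_k=\mathrm{rank}(\Sigma_k^o-AS_{k-1}A')$, let $$T_k=\begin{bmatrix}\bar\Lambda_k^{-1/2}&O\end{bmatrix}\bar U_k'(S_k-AS_{k-1}A')\bar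 U_k\begin{bmatrix}\bar\Lambda_k^{-1/2}\\O\end{bmatrix},$$ and let $T_k=U_k\Lambda_kU_k'$ be an eigen-decomposition, with $U_k$ orthogonal and $\Lambda_k=\mathrm{diag}(\lambda_{k,1},\dots,\lambda_{k,t_k})$. Such decompositions exist, and for every choice of them $\lambda_{k,i}\in[0,1]$ for all $i$. Hence there are real numbers $\lambda^o_{k,i},\theta_{k,i}$ with $$(\lambda^o_{k,i})^2+\theta_{k,i}^2>0,\qquad\frac{(\lambda^o_{k,i})^2}{(\lambda^o_{k,i})^2+\theta_{k,i}^2}=\lambda_{k,i}\qquad(1\le i\le t_k),$$ and for every choice of these decompositions and numbers, the memoryless rule $s_k=L_{k,k}'x_k+\vartheta_k$, $\vartheta_k\sim\mathcal N(0,\Theta_k)$, with $$L_{k,k}=\bar U_k\begin{bmatrix}\bar\Lambda_k^{-1/2}U_k\Lambda_k^o&O\\O&O\end{bmatrix},\quad\Lambda_k^o=\mathrm{diag}(\lambda^o_{k,1},\dots,\lambda^o_{k,t_k}),\quad\Theta_k=\mathrm{diag}(\theta_{k,1}^2,\dots,\theta_{k,t_k}^2,0,\dots,0),$$ satisfies $H_k=S_k$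 for all $k=1,\dots,\kappa$, under every control policy. -/

import Mathlib

open MeasureTheory ProbabilityTheory
open scoped Matrix

universe u

noncomputable section

/-- Euclidean space of column vectors of length `n`. -/
abbrev Vec (n : ℕ) : Type := EuclideanSpace ℝ (Fin n)

/-- The matrix-vector product `M x`. -/
def matVec {a b : ℕ} (M : Matrix (Fin a) (Fin b) ℝ) (x : Vec b) : Vec a :=
  WithLp.toLp 2 (M *ᵥ WithLp.ofLp x)

/-- Parameters of the Gauss-Markov plant `x_{k+1} = A x_k + B u_k + w_k`, with
`x_1 ∼ N(0, Σ₁)` and `w_k ∼ N(0, Σ_w)`. -/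
structure Plant (m r : ℕ) where
  /-- state matrix -/
  A : Matrix (Fin m) (Fin m) ℝ
  /-- input matrix -/
  B : Matrix (Fin m) (Fin r) ℝ
  /-- covariance of the initial state -/
  initCov : Matrix (Fin m) (Fin m) ℝ
  /-- covariance of the state noise -/
  stepCov : Matrix (Fin m) (Fin m) ℝ
  initCov_psd : initCov.PosSemidef
  stepCov_psd : stepCov.PosSemidef

/-- A linear-plus-noise signaling rule (the sensor observes the state perfectly):
`s_k = ∑_{j ≤ k} L_{k,j}' x_j + ϑ_k` with `ϑ_k ∼ N(0, Θ_k)`, where the gains `L_{k,j}` are arbitrary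
and the `Θ_k` are arbitrary positive semi-definite matrices.
Stages are numbered from `0`: index `k` is the `(k+1)`-st stage. -/
structure SignalingRule (m : ℕ) where
  /-- `gain k j` is `L_{k,j}`; only `j ≤ k` is ever used -/
  gain : ℕ → ℕ → Matrix (Fin m) (Fin m) ℝ
  /-- `noiseCov k` is `Θ_k` -/
  noiseCov : ℕ → Matrix (Fin m) (Fin m) ℝ
  noiseCov_psd : ∀ k, (noiseCov k).PosSemidef

/-- The rule is memoryless up to the horizon `κ`: `s_k = L_{k,k}' x_k + ϑ_k`. -/
def SignalingRule.IsMemoryless {m : ℕ} (η : SignalingRule m) (κ : ℕ) : Prop :=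
  ∀ k < κ, ∀ j < k, η.gain k j = 0

/-- A control policy: Borel measurable maps `u_k = γ_k(s_{1:k})`. -/
structure ControlPolicy (m r : ℕ) where
  /-- the map used at the stage with index `k`, where `k + 1` signals are available -/
  act : (k : ℕ) → (Fin (k + 1) → Vec m) → Vec r
  measurable_act : ∀ k, Measurable (act k)

/-- A realization, over the horizon `κ` and on the probability space `(Ω, μ)`, of the plant `P` in
closed loop with the signaling rule `η` and the control policy `γ`. -/
structure ClosedLoop {m r : ℕ} (P : Plant m r) (κ : ℕ) (η : SignalingRule m)
    (γ : ControlPolicy m r) {Ω : Type u} [MeasurableSpace Ω] (μ : Measure Ω) where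
  /-- state -/
  x : ℕ → Ω → Vec m
  /-- control input -/
  u : ℕ → Ω → Vec r
  /-- state noise -/
  w : ℕ → Ω → Vec m
  /-- signal -/
  s : ℕ → Ω → Vec m
  /-- signaling noise -/
  v : ℕ → Ω → Vec m
  measurable_init : Measurable (x 0)
  measurable_w : ∀ k < κ, Measurable (w k)
  measurable_v : ∀ k < κ, Measurable (v k)
  measurable_s : ∀ k < κ, Measurable (s k)
  init_law : HasLaw (x 0) (multivariateGaussian 0 P.initCov) μ
  w_law : ∀ k < κ, HasLaw (w k) (multivariateGaussian 0 P.stepCov) μ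
  v_law : ∀ k < κ, HasLaw (v k) (multivariateGaussian 0 (η.noiseCov k)) μ
  /-- initial state, state noises and signaling noises are mutually independent -/
  indep : iIndepFun (Sum.elim (fun _ : Unit => x 0)
    (Sum.elim (fun k : Fin κ => w k) (fun k : Fin κ => v k))) μ
  state_eq : ∀ k < κ, ∀ᵐ ω ∂μ,
    x (k + 1) ω = matVec P.A (x k ω) + matVec P.B (u k ω) + w k ω
  signal_eq : ∀ k < κ, ∀ᵐ ω ∂μ,
    s k ω = ∑ j ∈ Finset.range (k + 1), matVec (η.gain k j)ᵀ (x j ω) + v k ω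
  control_eq : ∀ k < κ, ∀ᵐ ω ∂μ, u k ω = γ.act k (fun j => s j ω)

/-- The covariance matrix of a random vector. -/
def covMatrix {Ω : Type u} [MeasurableSpace Ω] {m : ℕ} (μ : Measure Ω) (X : Ω → Vec m) :
    Matrix (Fin m) (Fin m) ℝ :=
  Matrix.of fun i j => cov[fun ω => X ω i, fun ω => X ω j; μ]

/-- The second moment matrix `E[X X']` of a random vector. -/
def secondMoment {Ω : Type u} [MeasurableSpace Ω] {m : ℕ} (μ : Measure Ω) (X : Ω → Vec m) :
    Matrix (Fin m) (Fin m) ℝ :=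
  Matrix.of fun i j => ∫ ω, X ω i * X ω j ∂μ

namespace ClosedLoop

variable {m r : ℕ} {P : Plant m r} {κ : ℕ} {η : SignalingRule m} {γ : ControlPolicy m r}
  {Ω : Type u} [MeasurableSpace Ω] {μ : Measure Ω}

/-- The control-free state: `x_1^o = x_1`, `x_{k+1}^o = A x_k^o + w_k`. -/
def free (c : ClosedLoop P κ η γ μ) : ℕ → Ω → Vec m
  | 0 => c.x 0
  | k + 1 => fun ω => matVec P.A (c.free k ω) + c.w k ω

/-- The σ-algebra generated by the signals `s_{1:k}`. -/
abbrev signalAlgebra (c : ClosedLoop P κ η γ μ) (k : ℕ) : MeasurableSpace Ω :=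
  MeasurableSpace.comap (fun ω (j : Fin (k + 1)) => c.s j ω) inferInstance

/-- `H_k = cov(E[x_k^o | s_{1:k}])`. -/
def posteriorCov (c : ClosedLoop P κ η γ μ) (k : ℕ) : Matrix (Fin m) (Fin m) ℝ :=
  covMatrix μ (μ[c.free k | c.signalAlgebra k])

end ClosedLoop

namespace Plant

variable {m r : ℕ}

/-- The covariance `Σ_k^o` of the control-free state: `Σ_1^o = Σ₁`,
`Σ_{k+1}^o = A Σ_k^o A' + Σ_w`. -/
def freeCov (P : Plant m r) : ℕ → Matrix (Fin m) (Fin m) ℝ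
  | 0 => P.initCov
  | k + 1 => P.A * P.freeCov k * P.Aᵀ + P.stepCov

/-- `A S_{k-1} A'`, which is read as `O` at the first stage. -/
def predCov (P : Plant m r) (S : ℕ → Matrix (Fin m) (Fin m) ℝ) : ℕ → Matrix (Fin m) (Fin m) ℝ
  | 0 => 0
  | k + 1 => P.A * S k * P.Aᵀ

/-- The linear matrix inequalities `Σ_1^o ⪰ H_1 ⪰ O` and
`Σ_k^o ⪰ H_k ⪰ A H_{k-1} A'` for `1 < k ≤ κ`. -/
def SatisfiesLMI (P : Plant m r) (κ : ℕ) (H : ℕ → Matrix (Fin m) (Fin m) ℝ) : Prop :=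
  (0 < κ → (P.freeCov 0 - H 0).PosSemidef ∧ (H 0).PosSemidef) ∧
  ∀ k, k + 1 < κ →
    (P.freeCov (k + 1) - H (k + 1)).PosSemidef ∧
    (H (k + 1) - P.A * H k * P.Aᵀ).PosSemidef

end Plant

/-- The `m × t` matrix `[I; O]`. For `t ≤ m` and a `t × t` matrix `M`, the product
`colEmb m t * M * (colEmb m t)ᵀ` is the `m × m` block matrix `[M O; O O]`. -/
def colEmb (m t : ℕ) : Matrix (Fin m) (Fin t) ℝ :=
  Matrix.of fun i j => if (i : ℕ) = (j : ℕ) then 1 else 0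

/-- Spectral data for a pair `D = Σ_k^o - A S_{k-1} A'`, `R = S_k - A S_{k-1} A'`:
an eigen-decomposition `D = Ū [Λ̄ O; O O] Ū'` with `Λ̄` diagonal and positive definite of size
`t = rank D`, and an eigen-decomposition `T = U Λ U'` of the normalized matrix
`T = [Λ̄^{-1/2} O] Ū' R Ū [Λ̄^{-1/2}; O]`. -/
structure SpectralData {m : ℕ} (D R : Matrix (Fin m) (Fin m) ℝ) where
  t : ℕ
  t_eq_rank : t = D.rank
  /-- `Ū` -/
  Ubar : Matrix (Fin m) (Fin m) ℝ
  /-- diagonal of `Λ̄` -/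
  lamBar : Fin t → ℝ
  /-- `U` -/
  U : Matrix (Fin t) (Fin t) ℝ
  /-- diagonal of `Λ`, the eigenvalues of `T` -/
  lam : Fin t → ℝ
  Ubar_mem : Ubar ∈ Matrix.orthogonalGroup (Fin m) ℝ
  lamBar_pos : ∀ i, 0 < lamBar i
  D_eq : D = Ubar * (colEmb m t * Matrix.diagonal lamBar * (colEmb m t)ᵀ) * Ubarᵀ
  U_mem : U ∈ Matrix.orthogonalGroup (Fin t) ℝ
  T_eq : (Matrix.diagonal (fun i => (Real.sqrt (lamBar i))⁻¹) * (colEmb m t)ᵀ) * Ubarᵀ * R * Ubar *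
      (colEmb m t * Matrix.diagonal (fun i => (Real.sqrt (lamBar i))⁻¹)) =
    U * Matrix.diagonal lam * Uᵀ

namespace SpectralData

variable {m : ℕ} {D R : Matrix (Fin m) (Fin m) ℝ}

/-- Scalars `a = (λ_i^o)_i` and `b = (θ_i)_i` with `a_i² / (a_i² + b_i²) = λ_i` for all `i`. -/
def IsWeights (d : SpectralData D R) (a b : Fin d.t → ℝ) : Prop :=
  ∀ i, 0 < a i ^ 2 + b i ^ 2 ∧ a i ^ 2 / (a i ^ 2 + b i ^ 2) = d.lam i

/-- The gain `Ū [Λ̄^{-1/2} U Λ^o  O; O O]` with `Λ^o = diag a`. -/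
def gain (d : SpectralData D R) (a : Fin d.t → ℝ) : Matrix (Fin m) (Fin m) ℝ :=
  d.Ubar * (colEmb m d.t *
    (Matrix.diagonal (fun i => (Real.sqrt (d.lamBar i))⁻¹) * d.U * Matrix.diagonal a) *
    (colEmb m d.t)ᵀ)

/-- The noise covariance `diag(b_1², …, b_t², 0, …, 0)`. -/
def noise (d : SpectralData D R) (b : Fin d.t → ℝ) : Matrix (Fin m) (Fin m) ℝ :=
  colEmb m d.t * Matrix.diagonal (fun i => b i ^ 2) * (colEmb m d.t)ᵀ

end SpectralData

/-- `Σ_k^o - A S_{k-1} A'` and `S_k - A S_{k-1} A'` have the given type of spectral data. -/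
abbrev StageData {m r : ℕ} (P : Plant m r) (S : ℕ → Matrix (Fin m) (Fin m) ℝ) (k : ℕ) : Type :=
  SpectralData (P.freeCov k - P.predCov S k) (S k - P.predCov S k)

/-- `η` is, over the horizon `κ`, a rule `s_k = L_{k,k}' x_k + ϑ_k` whose gains and noise covariances
are built from spectral data of `S` (some choice of the eigen-decompositions and of the weights). -/
def IsSpectralRule {m r : ℕ} (P : Plant m r) (κ : ℕ) (S : ℕ → Matrix (Fin m) (Fin m) ℝ)
    (η : SignalingRule m) : Prop :=
  η.IsMemoryless κ ∧
  ∀ k < κ, ∃ (d : StageData P S k) (a b : Fin d.t → ℝ),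
    d.IsWeights a b ∧ η.gain k k = d.gain a ∧ η.noiseCov k = d.noise b

end

/-!
The contribution of the controls to the state is a function of the past signals, so observing the
actual state through `s_k` carries the same information as observing the control-free state, and
the covariances of the filtering errors do not depend on the policy.

*Necessity.* Conditioning does not increase covariance, and more signals give a larger covariance of
the posterior mean; since `w_k` is independent of the signals up to time `k`, the prediction of
`x_{k+1}^o` from them is `A` times the posterior mean of `x_k^o`, with covariance `A H_k A'`.

*Sufficiency.* All variables are jointly Gaussian up to a function of the signals, so the error
covariance obeys the Kalman recursion. Before the `k`-th signal it is `D = Σ_k^o - A S_{k-1} A'`.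
In coordinates whitening `D` and diagonalizing `R = S_k - A S_{k-1} A'`, the signal consists of
independent scalar channels which remove the fractions `λ_{k,i}` of the unit variances, that is,
`R` in the original coordinates; what is left is `D - R = Σ_k^o - S_k`.
-/

noncomputable section

section MatVec

variable {a b : ℕ}

/-- `matVec M` as a continuous linear map, through which the linearity, continuity and
integration lemmas for such maps become available. -/
def matVecCLM (M : Matrix (Fin a) (Fin b) ℝ) : Vec b →L[ℝ] Vec a :=
  LinearMap.toContinuousLinearMap (Matrix.toLpLin 2 2 M)

lemma matVec_apply (M : Matrix (Fin a) (Fin b) ℝ) (x : Vec b) (i : Fin a) :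
    matVec M x i = ∑ j, M i j * x j := rfl

lemma matVec_zero (M : Matrix (Fin a) (Fin b) ℝ) : matVec M 0 = 0 := map_zero (matVecCLM M)

lemma matVec_add (M : Matrix (Fin a) (Fin b) ℝ) (x y : Vec b) :
    matVec M (x + y) = matVec M x + matVec M y := map_add (matVecCLM M) x y

lemma matVec_sub (M : Matrix (Fin a) (Fin b) ℝ) (x y : Vec b) :
    matVec M (x - y) = matVec M x - matVec M y := map_sub (matVecCLM M) x y

lemma zero_matVec (x : Vec b) : matVec (0 : Matrix (Fin a) (Fin b) ℝ) x = 0 := by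
  simp [matVec]

lemma one_matVec (x : Vec a) : matVec (1 : Matrix (Fin a) (Fin a) ℝ) x = x := by
  simp [matVec]

lemma neg_matVec (M : Matrix (Fin a) (Fin b) ℝ) (x : Vec b) : matVec (-M) x = -matVec M x := by
  simp [matVec, Matrix.neg_mulVec]

lemma sub_matVec (M N : Matrix (Fin a) (Fin b) ℝ) (x : Vec b) :
    matVec (M - N) x = matVec M x - matVec N x := by
  simp [matVec, Matrix.sub_mulVec]

lemma matVec_matVec {d : ℕ} (M : Matrix (Fin a) (Fin b) ℝ) (N : Matrix (Fin b) (Fin d) ℝ)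
    (x : Vec d) : matVec M (matVec N x) = matVec (M * N) x := by
  simp [matVec, Matrix.mulVec_mulVec]

@[fun_prop]
lemma continuous_matVec (M : Matrix (Fin a) (Fin b) ℝ) : Continuous (matVec M) :=
  (matVecCLM M).continuous

@[fun_prop]
lemma measurable_matVec (M : Matrix (Fin a) (Fin b) ℝ) : Measurable (matVec M) :=
  (continuous_matVec M).measurable

variable {Ω : Type*} [MeasurableSpace Ω] {μ : Measure Ω}

lemma memLp_matVec {X : Ω → Vec b} (hX : MemLp X 2 μ) (M : Matrix (Fin a) (Fin b) ℝ) :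
    MemLp (fun ω => matVec M (X ω)) 2 μ :=
  (matVecCLM M).comp_memLp' hX

lemma integral_matVec {X : Ω → Vec b} (hX : Integrable X μ) (M : Matrix (Fin a) (Fin b) ℝ) :
    ∫ ω, matVec M (X ω) ∂μ = matVec M (∫ ω, X ω ∂μ) :=
  (matVecCLM M).integral_comp_comm hX

end MatVec

section CrossCovariance

variable {Ω : Type u} [MeasurableSpace Ω] {μ : Measure Ω} {a b n : ℕ}

/-- The matrix of the covariances between the coordinates of two random vectors; it makes
`covMatrix μ X = crossCov μ X X` accessible to bilinear calculus. -/
def crossCov (μ : Measure Ω) (X : Ω → Vec a) (Y : Ω → Vec b) : Matrix (Fin a) (Fin b) ℝ :=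
  Matrix.of fun i j => cov[fun ω => X ω i, fun ω => Y ω j; μ]

lemma covMatrix_eq_crossCov (X : Ω → Vec a) : covMatrix μ X = crossCov μ X X := rfl

lemma crossCov_apply (X : Ω → Vec a) (Y : Ω → Vec b) (i : Fin a) (j : Fin b) :
    crossCov μ X Y i j = cov[fun ω => X ω i, fun ω => Y ω j; μ] := rfl

lemma crossCov_transpose (X : Ω → Vec a) (Y : Ω → Vec b) :
    (crossCov μ X Y)ᵀ = crossCov μ Y X := by
  ext i j
  exact covariance_comm _ _

lemma isHermitian_covMatrix (X : Ω → Vec a) : (covMatrix μ X).IsHermitian := by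
  rw [Matrix.IsHermitian, Matrix.conjTranspose_eq_transpose_of_trivial, covMatrix_eq_crossCov,
    crossCov_transpose]

lemma covMatrix_congr {X X' : Ω → Vec a} (h : X =ᵐ[μ] X') : covMatrix μ X = covMatrix μ X' := by
  have h_coord : ∀ i, (fun ω => X ω i) =ᵐ[μ] fun ω => X' ω i := fun i => h.fun_comp fun x => x i
  ext i j
  simp only [covMatrix, Matrix.of_apply, covariance, integral_congr_ae (h_coord _)]
  refine integral_congr_ae ?_
  filter_upwards [h] with ω hω
  rw [hω]

lemma covMatrix_of_hasLaw {X : Ω → Vec a} {S : Matrix (Fin a) (Fin a) ℝ} (hS : S.PosSemidef)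
    (hX : HasLaw X (multivariateGaussian 0 S) μ) : covMatrix μ X = S := by
  ext i j
  have h := hX.covariance_fun_comp (f := fun x => x i) (g := fun x => x j) (by fun_prop)
    (by fun_prop)
  rw [covMatrix, Matrix.of_apply, h, covariance_eval_multivariateGaussian hS]

lemma crossCov_eq_zero_of_indepFun {X : Ω → Vec a} {Y : Ω → Vec b} (h : IndepFun X Y μ)
    (hX : MemLp X 2 μ) (hY : MemLp Y 2 μ) : crossCov μ X Y = 0 := by
  ext i j
  exact IndepFun.covariance_eq_zero
    (h.comp (φ := fun x : Vec a => x i) (ψ := fun y : Vec b => y j) (by fun_prop) (by fun_prop))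
    (hX.eval_piLp i) (hY.eval_piLp j)

lemma secondMoment_eq_covMatrix {X : Ω → Vec a} (hX : Integrable X μ) (h0 : ∫ ω, X ω ∂μ = 0) :
    secondMoment μ X = covMatrix μ X := by
  have h : ∀ i, ∫ ω, X ω i ∂μ = 0 := fun i => by
    simpa [h0] using (EuclideanSpace.proj (𝕜 := ℝ) i).integral_comp_comm hX
  ext i j
  simp only [secondMoment, covMatrix, Matrix.of_apply, covariance, h, sub_zero]

variable [IsFiniteMeasure μ]

lemma crossCov_add_left {X Y : Ω → Vec a} {Z : Ω → Vec b} (hX : MemLp X 2 μ) (hY : MemLp Y 2 μ)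
    (hZ : MemLp Z 2 μ) :
    crossCov μ (fun ω => X ω + Y ω) Z = crossCov μ X Z + crossCov μ Y Z := by
  ext i j
  exact covariance_add_left (hX.eval_piLp i) (hY.eval_piLp i) (hZ.eval_piLp j)

lemma crossCov_sub_left {X Y : Ω → Vec a} {Z : Ω → Vec b} (hX : MemLp X 2 μ) (hY : MemLp Y 2 μ)
    (hZ : MemLp Z 2 μ) :
    crossCov μ (fun ω => X ω - Y ω) Z = crossCov μ X Z - crossCov μ Y Z := by
  ext i j
  exact covariance_sub_left (hX.eval_piLp i) (hY.eval_piLp i) (hZ.eval_piLp j)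

lemma crossCov_add_right {X Y : Ω → Vec b} {Z : Ω → Vec a} (hX : MemLp X 2 μ) (hY : MemLp Y 2 μ)
    (hZ : MemLp Z 2 μ) :
    crossCov μ Z (fun ω => X ω + Y ω) = crossCov μ Z X + crossCov μ Z Y := by
  ext i j
  exact covariance_add_right (hZ.eval_piLp i) (hX.eval_piLp j) (hY.eval_piLp j)

lemma crossCov_matVec_left {X : Ω → Vec n} {Y : Ω → Vec b} (hX : MemLp X 2 μ) (hY : MemLp Y 2 μ)
    (M : Matrix (Fin a) (Fin n) ℝ) :
    crossCov μ (fun ω => matVec M (X ω)) Y = M * crossCov μ X Y := by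
  ext i j
  simp only [crossCov_apply, matVec_apply, Matrix.mul_apply]
  rw [covariance_fun_sum_left (fun l => (hX.eval_piLp l).const_mul _) (hY.eval_piLp j)]
  simp only [covariance_const_mul_left]

lemma crossCov_matVec_right {X : Ω → Vec a} {Y : Ω → Vec n} (hX : MemLp X 2 μ) (hY : MemLp Y 2 μ)
    (M : Matrix (Fin b) (Fin n) ℝ) :
    crossCov μ X (fun ω => matVec M (Y ω)) = crossCov μ X Y * Mᵀ := by
  rw [← crossCov_transpose, crossCov_matVec_left hY hX, Matrix.transpose_mul, crossCov_transpose]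

lemma covMatrix_matVec {X : Ω → Vec n} (hX : MemLp X 2 μ) (M : Matrix (Fin a) (Fin n) ℝ) :
    covMatrix μ (fun ω => matVec M (X ω)) = M * covMatrix μ X * Mᵀ := by
  rw [covMatrix_eq_crossCov, crossCov_matVec_left hX (memLp_matVec hX M),
    crossCov_matVec_right hX hX, ← Matrix.mul_assoc, covMatrix_eq_crossCov]

lemma covMatrix_add_of_indepFun {X Y : Ω → Vec a} (h : IndepFun X Y μ) (hX : MemLp X 2 μ)
    (hY : MemLp Y 2 μ) :
    covMatrix μ (fun ω => X ω + Y ω) = covMatrix μ X + covMatrix μ Y := by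
  have hXY := crossCov_eq_zero_of_indepFun h hX hY
  have hYX := crossCov_eq_zero_of_indepFun h.symm hY hX
  rw [covMatrix_eq_crossCov, crossCov_add_left hX hY (Z := fun ω => X ω + Y ω) (hX.add hY),
    crossCov_add_right hX hY hX, crossCov_add_right hX hY hY, hXY, hYX, add_zero, zero_add,
    covMatrix_eq_crossCov, covMatrix_eq_crossCov]

lemma covariance_inner_inner {X : Ω → Vec a} {Y : Ω → Vec b} (hX : MemLp X 2 μ)
    (hY : MemLp Y 2 μ) (x : Vec a) (y : Vec b) :
    cov[fun ω => inner ℝ x (X ω), fun ω => inner ℝ y (Y ω); μ] =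
      x.ofLp ⬝ᵥ crossCov μ X Y *ᵥ y.ofLp := by
  simp only [PiLp.inner_apply, RCLike.inner_apply, conj_trivial]
  rw [covariance_fun_sum_fun_sum (fun i => (hX.eval_piLp i).mul_const _)
    (fun j => (hY.eval_piLp j).mul_const _)]
  simp only [covariance_mul_const_left, covariance_mul_const_right, dotProduct, Matrix.mulVec,
    Finset.mul_sum, crossCov_apply]
  exact Finset.sum_congr rfl fun i _ => Finset.sum_congr rfl fun j _ => by ring

lemma variance_inner {X : Ω → Vec a} (hX : MemLp X 2 μ) (x : Vec a) :
    Var[fun ω => inner ℝ x (X ω); μ] = x.ofLp ⬝ᵥ covMatrix μ X *ᵥ x.ofLp := by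
  rw [← covariance_self (hX.const_inner x).aemeasurable, covariance_inner_inner hX hX,
    covMatrix_eq_crossCov]

lemma posSemidef_covMatrix {X : Ω → Vec a} (hX : MemLp X 2 μ) : (covMatrix μ X).PosSemidef := by
  refine Matrix.PosSemidef.of_dotProduct_mulVec_nonneg (isHermitian_covMatrix X) fun z => ?_
  rw [star_trivial, ← variance_inner hX (WithLp.toLp 2 z)]
  exact variance_nonneg _ _

end CrossCovariance

section ConditionalCovariance

variable {Ω : Type u} {m₁ m₂ m₀ : MeasurableSpace Ω} {μ : Measure[m₀] Ω}
  [IsProbabilityMeasure μ] {a : ℕ}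

lemma variance_condExp_le (hm : m₁ ≤ m₀) {X : Ω → ℝ} (hX : MemLp X 2 μ) :
    Var[μ[X | m₁]; μ] ≤ Var[X; μ] := by
  rw [← integral_condVar_add_variance_condExp hm hX]
  refine le_add_of_nonneg_left (integral_nonneg_of_ae ?_)
  exact condExp_nonneg (.of_forall fun ω => sq_nonneg _)

lemma posSemidef_covMatrix_sub_condExp (hm : m₁ ≤ m₀) {X : Ω → Vec a} (hX : MemLp X 2 μ) :
    (covMatrix μ X - covMatrix μ (μ[X | m₁])).PosSemidef := by
  refine Matrix.PosSemidef.of_dotProduct_mulVec_nonneg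
    ((isHermitian_covMatrix X).sub (isHermitian_covMatrix _)) fun z => ?_
  let x : Vec a := WithLp.toLp 2 z
  have hcomm : (fun ω => inner ℝ x ((μ[X | m₁]) ω)) =ᵐ[μ] μ[fun ω => inner ℝ x (X ω) | m₁] :=
    (innerSL ℝ x).comp_condExp_comm (hX.integrable one_le_two)
  rw [star_trivial, Matrix.sub_mulVec, dotProduct_sub, sub_nonneg, ← variance_inner hX x,
    ← variance_inner (hX.condExp one_le_two) x, variance_congr hcomm]
  exact variance_condExp_le hm (hX.const_inner x)

lemma posSemidef_covMatrix_condExp_sub_condExp (h₁₂ : m₁ ≤ m₂) (hm : m₂ ≤ m₀)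
    {X : Ω → Vec a} (hX : MemLp X 2 μ) :
    (covMatrix μ (μ[X | m₂]) - covMatrix μ (μ[X | m₁])).PosSemidef := by
  rw [← covMatrix_congr (condExp_condExp_of_le h₁₂ hm)]
  exact posSemidef_covMatrix_sub_condExp (h₁₂.trans hm) (hX.condExp one_le_two)

end ConditionalCovariance

section Independence

variable {Ω α β δ : Type*} {mΩ : MeasurableSpace Ω} {μ : Measure Ω} [MeasurableSpace α]
  [MeasurableSpace β] [MeasurableSpace δ]

lemma indepFun_prodMk_assoc [IsFiniteMeasure μ] {X : Ω → α} {Y : Ω → β} {Z : Ω → δ}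
    (hX : AEMeasurable X μ) (hY : AEMeasurable Y μ) (hZ : AEMeasurable Z μ) (hXY : IndepFun X Y μ)
    (hXYZ : IndepFun (fun ω => (X ω, Y ω)) Z μ) : IndepFun X (fun ω => (Y ω, Z ω)) μ := by
  have hYZ : IndepFun Y Z μ := hXYZ.comp measurable_snd measurable_id
  rw [indepFun_iff_map_prod_eq_prod_map_map hX (hY.prodMk hZ),
    (indepFun_iff_map_prod_eq_prod_map_map hY hZ).1 hYZ, ← Measure.prodAssoc_prod,
    ← (indepFun_iff_map_prod_eq_prod_map_map hX hY).1 hXY,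
    ← (indepFun_iff_map_prod_eq_prod_map_map (hX.prodMk hY) hZ).1 hXYZ,
    AEMeasurable.map_map_of_aemeasurable MeasurableEquiv.prodAssoc.measurable.aemeasurable
      ((hX.prodMk hY).prodMk hZ)]
  rfl

lemma condExp_comap_of_indepFun [IsFiniteMeasure μ] {E : Type*} [NormedAddCommGroup E]
    [NormedSpace ℝ E] [CompleteSpace E] [MeasurableSpace E] [BorelSpace E]
    [SecondCountableTopology E] {X : Ω → E} {Y : Ω → β} (hX : Measurable X) (hY : Measurable Y)
    (h : IndepFun X Y μ) :
    μ[X | MeasurableSpace.comap Y inferInstance] =ᵐ[μ] fun _ => ∫ ω, X ω ∂μ :=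
  condExp_indep_eq hX.comap_le hY.comap_le (comap_measurable X).stronglyMeasurable
    ((IndepFun_iff_Indep _ _ _).1 h)

lemma indepFun_of_aestronglyMeasurable [TopologicalSpace β]
    [TopologicalSpace.PseudoMetrizableSpace β] [BorelSpace β] {M : MeasurableSpace Ω} {X : Ω → α}
    {Y : Ω → β} (hX : Indep (MeasurableSpace.comap X inferInstance) M μ)
    (hY : AEStronglyMeasurable[M] Y μ) : IndepFun X Y μ := by
  refine IndepFun.congr ?_ (ae_eq_refl X) hY.ae_eq_mk.symm
  rw [IndepFun_iff_Indep]
  exact indep_of_indep_of_le_right hX hY.stronglyMeasurable_mk.measurable.comap_le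

lemma aestronglyMeasurable_pi {ι : Type*} [Countable ι] {E : ι → Type*}
    [∀ i, TopologicalSpace (E i)] [∀ i, TopologicalSpace.PseudoMetrizableSpace (E i)]
    [∀ i, SecondCountableTopology (E i)] [∀ i, MeasurableSpace (E i)] [∀ i, BorelSpace (E i)]
    {M : MeasurableSpace Ω} {f : ∀ i, Ω → E i}
    (hf : ∀ i, AEStronglyMeasurable[M] (f i) μ) :
    AEStronglyMeasurable[M] (fun ω i => f i ω) μ := by
  refine ⟨fun ω i => (hf i).mk _ ω, ?_, ?_⟩
  · exact (measurable_pi_lambda _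
      fun i => (hf i).stronglyMeasurable_mk.measurable).stronglyMeasurable
  · filter_upwards [ae_all_iff.2 fun i => (hf i).ae_eq_mk] with ω hω
    exact funext hω

lemma aestronglyMeasurable_measurable_comp [TopologicalSpace α] [BorelSpace α]
    [TopologicalSpace.PseudoMetrizableSpace α] [TopologicalSpace β]
    [TopologicalSpace.PseudoMetrizableSpace β] [SecondCountableTopology β] [OpensMeasurableSpace β]
    {M : MeasurableSpace Ω} {f : Ω → α} {g : α → β} (hg : Measurable g)
    (hf : AEStronglyMeasurable[M] f μ) : AEStronglyMeasurable[M] (fun ω => g (f ω)) μ :=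
  ⟨fun ω => g (hf.mk f ω), (hg.comp hf.stronglyMeasurable_mk.measurable).stronglyMeasurable,
    hf.ae_eq_mk.fun_comp g⟩

end Independence

/-- `X` is a centered Gaussian vector with covariance matrix `Q`, which may be singular. -/
structure IsCenteredGaussian {Ω : Type u} [MeasurableSpace Ω] {a : ℕ} (X : Ω → Vec a)
    (Q : Matrix (Fin a) (Fin a) ℝ) (μ : Measure Ω) : Prop where
  hasGaussianLaw : HasGaussianLaw X μ
  integral_eq_zero : ∫ ω, X ω ∂μ = 0
  covMatrix_eq : covMatrix μ X = Q

namespace IsCenteredGaussian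

variable {Ω : Type u} [MeasurableSpace Ω] {μ : Measure Ω} {a b p : ℕ} {X Y : Ω → Vec a}
  {Q N : Matrix (Fin a) (Fin a) ℝ}

lemma of_hasLaw (hQ : Q.PosSemidef) (hX : HasLaw X (multivariateGaussian 0 Q) μ) :
    IsCenteredGaussian X Q μ where
  hasGaussianLaw := hX.hasGaussianLaw
  integral_eq_zero := by rw [hX.integral_eq, integral_id_multivariateGaussian]
  covMatrix_eq := covMatrix_of_hasLaw hQ hX

lemma memLp (hX : IsCenteredGaussian X Q μ) : MemLp X 2 μ := hX.hasGaussianLaw.memLp_two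

lemma integrable (hX : IsCenteredGaussian X Q μ) : Integrable X μ := hX.hasGaussianLaw.integrable

lemma aemeasurable (hX : IsCenteredGaussian X Q μ) : AEMeasurable X μ :=
  hX.hasGaussianLaw.aemeasurable

lemma isProbabilityMeasure (hX : IsCenteredGaussian X Q μ) : IsProbabilityMeasure μ :=
  hX.hasGaussianLaw.isProbabilityMeasure

lemma congr (hX : IsCenteredGaussian X Q μ) (h : X =ᵐ[μ] Y) : IsCenteredGaussian Y Q μ where
  hasGaussianLaw := hX.hasGaussianLaw.congr h
  integral_eq_zero := integral_congr_ae h ▸ hX.integral_eq_zero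
  covMatrix_eq := covMatrix_congr h ▸ hX.covMatrix_eq

lemma matVec (hX : IsCenteredGaussian X Q μ) (M : Matrix (Fin b) (Fin a) ℝ) :
    IsCenteredGaussian (fun ω => matVec M (X ω)) (M * Q * Mᵀ) μ := by
  have := hX.isProbabilityMeasure
  refine ⟨hX.hasGaussianLaw.map_fun (matVecCLM M), ?_, ?_⟩
  · rw [integral_matVec hX.integrable, hX.integral_eq_zero, matVec_zero]
  · rw [covMatrix_matVec hX.memLp, hX.covMatrix_eq]

lemma add (hX : IsCenteredGaussian X Q μ) (hY : IsCenteredGaussian Y N μ) (h : IndepFun X Y μ) :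
    IsCenteredGaussian (fun ω => X ω + Y ω) (Q + N) μ := by
  have := hX.isProbabilityMeasure
  refine ⟨(h.hasGaussianLaw hX.hasGaussianLaw hY.hasGaussianLaw).fun_add, ?_, ?_⟩
  · rw [integral_add hX.integrable hY.integrable, hX.integral_eq_zero, hY.integral_eq_zero,
      add_zero]
  · rw [covMatrix_add_of_indepFun h hX.memLp hY.memLp, hX.covMatrix_eq, hY.covMatrix_eq]

end IsCenteredGaussian

lemma indepFun_of_crossCov_eq_zero {Ω : Type u} [MeasurableSpace Ω] {μ : Measure Ω} {a b : ℕ}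
    {X : Ω → Vec a} {Y : Ω → Vec b} (hXY : HasGaussianLaw (fun ω => (X ω, Y ω)) μ)
    (h : crossCov μ X Y = 0) : IndepFun X Y μ := by
  have := hXY.isProbabilityMeasure
  refine hXY.indepFun_of_covariance_inner fun x y => ?_
  rw [covariance_inner_inner hXY.fst.memLp_two hXY.snd.memLp_two, h, Matrix.zero_mulVec,
    dotProduct_zero]

section Regression

variable {Ω : Type u} [MeasurableSpace Ω] {μ : Measure Ω} {a p : ℕ} {e : Ω → Vec a}
  {V : Ω → Vec p} {Q : Matrix (Fin a) (Fin a) ℝ} {N : Matrix (Fin p) (Fin p) ℝ}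
  {C : Matrix (Fin p) (Fin a) ℝ} {K : Matrix (Fin a) (Fin p) ℝ}

lemma indepFun_sub_gain_innovation (he : IsCenteredGaussian e Q μ)
    (hV : IsCenteredGaussian V N μ) (heV : IndepFun e V μ)
    (hK : K * (C * Q * Cᵀ + N) = Q * Cᵀ) :
    IndepFun (fun ω => e ω - matVec K (matVec C (e ω) + V ω)) (fun ω => matVec C (e ω) + V ω)
      μ := by
  have := he.isProbabilityMeasure
  have hCe := he.matVec C
  have hι := hCe.add hV (heV.comp (measurable_matVec C) measurable_id)
  let innovation : Vec a × Vec p →L[ℝ] Vec p :=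
    matVecCLM C ∘L ContinuousLinearMap.fst ℝ _ _ + ContinuousLinearMap.snd ℝ _ _
  let residual : Vec a × Vec p →L[ℝ] Vec a :=
    ContinuousLinearMap.fst ℝ _ _ - matVecCLM K ∘L innovation
  refine indepFun_of_crossCov_eq_zero ((heV.hasGaussianLaw he.hasGaussianLaw
    hV.hasGaussianLaw).map_fun (residual.prod innovation)) ?_
  rw [crossCov_sub_left he.memLp (memLp_matVec hι.memLp K) hι.memLp,
    crossCov_matVec_left hι.memLp hι.memLp, ← covMatrix_eq_crossCov, hι.covMatrix_eq, hK,
    crossCov_add_right hCe.memLp hV.memLp he.memLp, crossCov_matVec_right he.memLp he.memLp,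
    ← covMatrix_eq_crossCov, he.covMatrix_eq, crossCov_eq_zero_of_indepFun heV he.memLp hV.memLp,
    add_zero, sub_self]

lemma isCenteredGaussian_sub_gain_innovation (he : IsCenteredGaussian e Q μ)
    (hV : IsCenteredGaussian V N μ) (heV : IndepFun e V μ)
    (hK : K * (C * Q * Cᵀ + N) = Q * Cᵀ) :
    IsCenteredGaussian (fun ω => e ω - matVec K (matVec C (e ω) + V ω)) (Q - K * C * Q) μ := by
  have h := (he.matVec (1 - K * C)).add (hV.matVec (-K))
    (heV.comp (measurable_matVec _) (measurable_matVec _))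
  have hQ : (1 - K * C) * Q * (1 - K * C)ᵀ + -K * N * (-K)ᵀ = Q - K * C * Q :=
    calc (1 - K * C) * Q * (1 - K * C)ᵀ + -K * N * (-K)ᵀ
        = Q - K * C * Q - (Q * Cᵀ - K * (C * Q * Cᵀ + N)) * Kᵀ := by
          simp only [Matrix.transpose_sub, Matrix.transpose_one, Matrix.transpose_mul,
            Matrix.transpose_neg]
          simp only [Matrix.sub_mul, Matrix.mul_sub, Matrix.mul_add, Matrix.add_mul,
            Matrix.neg_mul, Matrix.mul_neg, Matrix.one_mul, Matrix.mul_one, Matrix.mul_assoc]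
          abel
      _ = Q - K * C * Q := by rw [hK, sub_self, Matrix.zero_mul, sub_zero]
  rw [hQ] at h
  convert h using 2 with ω
  rw [sub_matVec, one_matVec, neg_matVec, ← matVec_matVec, matVec_add]
  abel

end Regression

/-- `f Y` estimates `X` from the observation `Y` with an error that is a centered Gaussian vector
of covariance `Q`, independent of `Y`. This is the invariant of the Kalman filter: it forces
`f Y` to be the conditional expectation of `X` given `Y`. -/
structure IsGaussianEstimate {Ω β : Type*} [MeasurableSpace Ω] [MeasurableSpace β] {a : ℕ}
    (X : Ω → Vec a) (Y : Ω → β) (f : β → Vec a) (Q : Matrix (Fin a) (Fin a) ℝ) (μ : Measure Ω) :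
    Prop where
  measurable_estimator : Measurable f
  isCenteredGaussian_error : IsCenteredGaussian (fun ω => X ω - f (Y ω)) Q μ
  indepFun_error : IndepFun (fun ω => X ω - f (Y ω)) Y μ

namespace IsGaussianEstimate

variable {Ω : Type u} {β : Type*} [MeasurableSpace Ω] {μ : Measure Ω} [MeasurableSpace β]
  {a b p : ℕ} {X : Ω → Vec a} {Y : Ω → β} {f : β → Vec a} {Q : Matrix (Fin a) (Fin a) ℝ}

lemma of_unique [Unique β] (hX : IsCenteredGaussian X Q μ) :
    IsGaussianEstimate X Y (fun _ => 0) Q μ := by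
  have := hX.isProbabilityMeasure
  have hY : Y = fun _ => default := funext fun _ => Subsingleton.elim _ _
  refine ⟨measurable_const, by simpa only [sub_zero] using hX, ?_⟩
  rw [hY]
  exact indepFun_const_right _ _

lemma map_observation {β' : Type*} [MeasurableSpace β'] (h : IsGaussianEstimate X Y f Q μ)
    (φ : β ≃ᵐ β') : IsGaussianEstimate X (fun ω => φ (Y ω)) (fun y => f (φ.symm y)) Q μ where
  measurable_estimator := h.measurable_estimator.comp φ.symm.measurable
  isCenteredGaussian_error := by
    simpa only [MeasurableEquiv.symm_apply_apply] using h.isCenteredGaussian_error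
  indepFun_error := by
    simpa only [MeasurableEquiv.symm_apply_apply, Function.comp_def, id] using
      h.indepFun_error.comp measurable_id φ.measurable

lemma indepFun_observation_error_noise {V : Ω → Vec p} (h : IsGaussianEstimate X Y f Q μ)
    (hY : AEMeasurable Y μ) (hV : AEMeasurable V μ)
    (hXYV : IndepFun (fun ω => (X ω, Y ω)) V μ) :
    IndepFun Y (fun ω => (X ω - f (Y ω), V ω)) μ := by
  have := h.isCenteredGaussian_error.isProbabilityMeasure
  have hf := h.measurable_estimator
  refine indepFun_prodMk_assoc hY h.isCenteredGaussian_error.aemeasurable hV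
    h.indepFun_error.symm (hXYV.comp (φ := fun z => (z.2, z.1 - f z.2)) ?_ measurable_id)
  fun_prop

lemma indepFun_error_noise {V : Ω → Vec p} (h : IsGaussianEstimate X Y f Q μ)
    (hXYV : IndepFun (fun ω => (X ω, Y ω)) V μ) : IndepFun (fun ω => X ω - f (Y ω)) V μ := by
  have hf := h.measurable_estimator
  refine hXYV.comp (φ := fun z => z.1 - f z.2) ?_ measurable_id
  fun_prop

theorem predict {W : Ω → Vec b} {N : Matrix (Fin b) (Fin b) ℝ}
    (h : IsGaussianEstimate X Y f Q μ) (hY : AEMeasurable Y μ) (hW : IsCenteredGaussian W N μ)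
    (hXYW : IndepFun (fun ω => (X ω, Y ω)) W μ) (A : Matrix (Fin b) (Fin a) ℝ) :
    IsGaussianEstimate (fun ω => matVec A (X ω) + W ω) Y (fun y => matVec A (f y))
      (A * Q * Aᵀ + N) μ := by
  have h_err : (fun ω => matVec A (X ω) + W ω - matVec A (f (Y ω))) =
      fun ω => matVec A (X ω - f (Y ω)) + W ω := by
    funext ω
    rw [matVec_sub]
    abel
  refine ⟨(measurable_matVec A).comp h.measurable_estimator, ?_, ?_⟩ <;> rw [h_err]
  · exact (h.isCenteredGaussian_error.matVec A).add hW
      ((h.indepFun_error_noise hXYW).comp (measurable_matVec A) measurable_id)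
  · have h_meas : Measurable fun z : Vec a × Vec b => matVec A z.1 + z.2 := by fun_prop
    exact ((h.indepFun_observation_error_noise hY hW.aemeasurable hXYW).comp measurable_id
      h_meas).symm

section Update

variable {V s : Ω → Vec p} {N : Matrix (Fin p) (Fin p) ℝ} {C : Matrix (Fin p) (Fin a) ℝ}
  {K : Matrix (Fin a) (Fin p) ℝ} {g : β → Vec p}

lemma indepFun_updatedError (h : IsGaussianEstimate X Y f Q μ) (hY : AEMeasurable Y μ)
    (hV : IsCenteredGaussian V N μ) (hXYV : IndepFun (fun ω => (X ω, Y ω)) V μ)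
    (hK : K * (C * Q * Cᵀ + N) = Q * Cᵀ) :
    IndepFun (fun ω => X ω - f (Y ω) - matVec K (matVec C (X ω - f (Y ω)) + V ω))
      (fun ω => (matVec C (X ω - f (Y ω)) + V ω, Y ω)) μ := by
  have he := h.isCenteredGaussian_error
  have := he.isProbabilityMeasure
  have hι := ((he.matVec C).add hV
    ((h.indepFun_error_noise hXYV).comp (measurable_matVec C) measurable_id)).aemeasurable
  refine indepFun_prodMk_assoc (by have := he.aemeasurable; fun_prop) hι hY
    (indepFun_sub_gain_innovation he hV (h.indepFun_error_noise hXYV) hK) ?_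
  have h_meas : Measurable fun z : Vec a × Vec p =>
      (z.1 - matVec K (matVec C z.1 + z.2), matVec C z.1 + z.2) := by
    fun_prop
  exact ((h.indepFun_observation_error_noise hY hV.aemeasurable hXYV).comp measurable_id
    h_meas).symm

theorem update (h : IsGaussianEstimate X Y f Q μ) (hY : AEMeasurable Y μ)
    (hV : IsCenteredGaussian V N μ) (hXYV : IndepFun (fun ω => (X ω, Y ω)) V μ)
    (hg : Measurable g) (hs : s =ᵐ[μ] fun ω => matVec C (X ω) + g (Y ω) + V ω)
    (hK : K * (C * Q * Cᵀ + N) = Q * Cᵀ) :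
    IsGaussianEstimate X (fun ω => (s ω, Y ω))
      (fun z => f z.2 + matVec K (z.1 - (matVec C (f z.2) + g z.2))) (Q - K * C * Q) μ := by
  have hf := h.measurable_estimator
  have h_err : (fun ω => X ω - f (Y ω) - matVec K (matVec C (X ω - f (Y ω)) + V ω)) =ᵐ[μ]
      fun ω => X ω - (f (Y ω) + matVec K (s ω - (matVec C (f (Y ω)) + g (Y ω)))) := by
    filter_upwards [hs] with ω hω
    rw [hω, matVec_sub C, sub_sub]
    congr 3
    abel
  have h_obs : (fun ω => (matVec C (X ω - f (Y ω)) + V ω + (matVec C (f (Y ω)) + g (Y ω)), Y ω))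
      =ᵐ[μ] fun ω => (s ω, Y ω) := by
    filter_upwards [hs] with ω hω
    rw [hω, matVec_sub]
    congr 1
    abel
  refine ⟨by fun_prop, ?_, ?_⟩
  · exact (isCenteredGaussian_sub_gain_innovation h.isCenteredGaussian_error hV
      (h.indepFun_error_noise hXYV) hK).congr h_err
  · have h_meas : Measurable fun z : Vec p × β => (z.1 + (matVec C (f z.2) + g z.2), z.2) := by
      fun_prop
    exact ((h.indepFun_updatedError hY hV hXYV hK).comp measurable_id h_meas).congr h_err h_obs

end Update

lemma memLp_estimator (h : IsGaussianEstimate X Y f Q μ) (hX : MemLp X 2 μ) :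
    MemLp (fun ω => f (Y ω)) 2 μ := by
  simpa only [Pi.sub_def, sub_sub_cancel] using hX.sub h.isCenteredGaussian_error.memLp

lemma condExp_ae_eq (h : IsGaussianEstimate X Y f Q μ) (hX : Measurable X) (hY : Measurable Y)
    (hX_int : Integrable X μ) :
    μ[X | MeasurableSpace.comap Y inferInstance] =ᵐ[μ] fun ω => f (Y ω) := by
  have he := h.isCenteredGaussian_error
  have := he.isProbabilityMeasure
  have hf := h.measurable_estimator
  have hfY : Integrable (fun ω => f (Y ω)) μ := by
    simpa only [Pi.sub_def, sub_sub_cancel] using hX_int.sub he.integrable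
  have h_sum : X = (fun ω => X ω - f (Y ω)) + fun ω => f (Y ω) :=
    funext fun ω => (sub_add_cancel _ _).symm
  have h_err := condExp_comap_of_indepFun (by fun_prop) hY h.indepFun_error
  have h_est : μ[fun ω => f (Y ω) | MeasurableSpace.comap Y inferInstance] = fun ω => f (Y ω) :=
    condExp_of_stronglyMeasurable hY.comap_le
      (hf.comp (comap_measurable Y)).stronglyMeasurable hfY
  nth_rw 1 [h_sum]
  filter_upwards [condExp_add he.integrable hfY (MeasurableSpace.comap Y inferInstance), h_err]
    with ω h_add h_zero
  rw [h_add, Pi.add_apply, h_zero, he.integral_eq_zero, h_est, zero_add]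

theorem covMatrix_condExp (h : IsGaussianEstimate X Y f Q μ) (hX : Measurable X)
    (hY : Measurable Y) (hX_Lp : MemLp X 2 μ) :
    covMatrix μ (μ[X | MeasurableSpace.comap Y inferInstance]) = covMatrix μ X - Q := by
  have he := h.isCenteredGaussian_error
  have := he.isProbabilityMeasure
  have h_cov := covMatrix_add_of_indepFun
    (h.indepFun_error.comp measurable_id h.measurable_estimator) he.memLp
    (h.memLp_estimator hX_Lp)
  simp only [Function.comp_def, id, sub_add_cancel] at h_cov
  rw [covMatrix_congr (h.condExp_ae_eq hX hY (hX_Lp.integrable one_le_two)), h_cov,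
    he.covMatrix_eq, add_sub_cancel_left]

end IsGaussianEstimate

lemma mulVec_eq_zero_of_posSemidef_sub {ι : Type*} [Fintype ι] {D R : Matrix ι ι ℝ} {v : ι → ℝ}
    (hR : R.PosSemidef) (hDR : (D - R).PosSemidef) (hDv : D *ᵥ v = 0) : R *ᵥ v = 0 := by
  rw [← hR.dotProduct_mulVec_zero_iff]
  refine le_antisymm ?_ (hR.dotProduct_mulVec_nonneg _)
  have h := hDR.dotProduct_mulVec_nonneg v
  rw [Matrix.sub_mulVec, dotProduct_sub, hDv, dotProduct_zero, zero_sub] at h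
  exact neg_nonneg.1 h

lemma mul_transpose_mul_mul_mul_transpose_of_posSemidef_sub {ι τ : Type*} [Fintype ι] [Fintype τ]
    [DecidableEq τ] {R : Matrix ι ι ℝ} {V W : Matrix ι τ ℝ} (hWV : Wᵀ * V = 1)
    (hR : R.PosSemidef) (hVR : (V * Vᵀ - R).PosSemidef) : V * (Wᵀ * R * W) * Vᵀ = R := by
  classical
  have hVW : Vᵀ * W = 1 := by
    rw [← Matrix.transpose_transpose W, ← Matrix.transpose_mul, hWV, Matrix.transpose_one]
  have h_ker : V * Vᵀ * (1 - W * Vᵀ) = 0 := by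
    rw [Matrix.mul_sub, Matrix.mul_one, Matrix.mul_assoc V, ← Matrix.mul_assoc Vᵀ, hVW,
      Matrix.one_mul, sub_self]
  have h_ker_R : R * (1 - W * Vᵀ) = 0 := by
    refine Matrix.ext_iff_mulVec.2 fun z => ?_
    rw [Matrix.zero_mulVec, ← Matrix.mulVec_mulVec]
    refine mulVec_eq_zero_of_posSemidef_sub hR hVR ?_
    rw [Matrix.mulVec_mulVec, h_ker, Matrix.zero_mulVec]
  have h_right : R * (W * Vᵀ) = R := by
    simpa only [Matrix.mul_sub, Matrix.mul_one, sub_eq_zero, eq_comm] using h_ker_R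
  have h_symm : Rᵀ = R := by
    rw [← Matrix.conjTranspose_eq_transpose_of_trivial, hR.isHermitian]
  have h_left : V * Wᵀ * R = R := by
    simpa [Matrix.transpose_mul, h_symm] using congrArg Matrix.transpose h_right
  calc V * (Wᵀ * R * W) * Vᵀ = V * Wᵀ * (R * (W * Vᵀ)) := by simp only [Matrix.mul_assoc]
    _ = R := by rw [h_right, h_left]

lemma colEmb_transpose_mul_colEmb {m t : ℕ} (h : t ≤ m) : (colEmb m t)ᵀ * colEmb m t = 1 := by
  ext i j
  rw [Matrix.mul_apply, Finset.sum_eq_single (Fin.castLE h i)]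
  · simp [colEmb, Fin.ext_iff, Matrix.one_apply]
  · intro b _ hb
    have : (b : ℕ) ≠ i := fun h' => hb (Fin.ext h')
    simp [colEmb, this]
  · simp

lemma colEmb_mul_diagonal_castLE_mul_transpose {m t : ℕ} (h : t ≤ m) {f : Fin m → ℝ}
    (hf : ∀ i : Fin m, t ≤ i → f i = 0) :
    colEmb m t * Matrix.diagonal (fun i => f (Fin.castLE h i)) * (colEmb m t)ᵀ =
      Matrix.diagonal f := by
  ext i j
  rw [Matrix.mul_apply]
  simp only [Matrix.mul_diagonal, Matrix.transpose_apply, colEmb, Matrix.of_apply]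
  rcases lt_or_ge (i : ℕ) t with hi | hi
  · rw [Finset.sum_eq_single ⟨i, hi⟩]
    · rcases eq_or_ne i j with rfl | hij
      · simp
      · simp [hij, Fin.val_ne_of_ne hij.symm]
    · intro l _ hl
      have : (i : ℕ) ≠ l := fun h' => hl (Fin.ext h'.symm)
      simp [this]
    · simp
  · rw [Finset.sum_eq_zero]
    · simp [Matrix.diagonal_apply, hf i hi]
    · intro l _
      simp [(l.2.trans_le hi).ne']

namespace SpectralData

variable {m : ℕ} {D R : Matrix (Fin m) (Fin m) ℝ} (d : SpectralData D R)

/-- The whitening matrix `Ū [Λ̄^{-1/2}; O] U`: it turns covariance `D` into the identity and `R`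
into the diagonal matrix `Λ`. -/
def whitening : Matrix (Fin m) (Fin d.t) ℝ :=
  d.Ubar * (colEmb m d.t * Matrix.diagonal (fun i => (√(d.lamBar i))⁻¹) * d.U)

/-- The coloring matrix `Ū [Λ̄^{1/2}; O] U`, the factor of `D` inverse to `whitening`. -/
def coloring : Matrix (Fin m) (Fin d.t) ℝ :=
  d.Ubar * (colEmb m d.t * Matrix.diagonal (fun i => √(d.lamBar i)) * d.U)

lemma t_le : d.t ≤ m := d.t_eq_rank ▸ D.rank_le_width

lemma coloring_mul_transpose : d.coloring * d.coloringᵀ = D := by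
  have hU : d.U * d.Uᵀ = 1 := (Matrix.mem_orthogonalGroup_iff _ _).1 d.U_mem
  have h_sqrt : (Matrix.diagonal fun i => √(d.lamBar i)) * (Matrix.diagonal fun i => √(d.lamBar i))
      = Matrix.diagonal d.lamBar := by
    simp only [Matrix.diagonal_mul_diagonal, Real.mul_self_sqrt (d.lamBar_pos _).le]
  conv_rhs => rw [d.D_eq]
  rw [coloring, ← h_sqrt]
  simp only [Matrix.transpose_mul, Matrix.diagonal_transpose, Matrix.mul_assoc]
  rw [← Matrix.mul_assoc d.U, hU, Matrix.one_mul]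

lemma whitening_transpose_mul_coloring : d.whiteningᵀ * d.coloring = 1 := by
  have hU : d.Uᵀ * d.U = 1 := (Matrix.mem_orthogonalGroup_iff' _ _).1 d.U_mem
  have hUbar : d.Ubarᵀ * d.Ubar = 1 := (Matrix.mem_orthogonalGroup_iff' _ _).1 d.Ubar_mem
  have h_sqrt : (Matrix.diagonal fun i => (√(d.lamBar i))⁻¹) *
      (Matrix.diagonal fun i => √(d.lamBar i)) = 1 := by
    simp only [Matrix.diagonal_mul_diagonal, Matrix.diagonal_one,
      inv_mul_cancel₀ (Real.sqrt_pos.2 (d.lamBar_pos _)).ne']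
  calc d.whiteningᵀ * d.coloring
      = d.Uᵀ * (Matrix.diagonal (fun i => (√(d.lamBar i))⁻¹) * (((colEmb m d.t)ᵀ *
          ((d.Ubarᵀ * d.Ubar) * colEmb m d.t)) * Matrix.diagonal fun i => √(d.lamBar i))) *
          d.U := by
        simp only [whitening, coloring, Matrix.transpose_mul, Matrix.diagonal_transpose,
          Matrix.mul_assoc]
    _ = 1 := by
        rw [hUbar, Matrix.one_mul, colEmb_transpose_mul_colEmb d.t_le, Matrix.one_mul, h_sqrt,
          Matrix.mul_one, hU]

lemma whitening_transpose_mul_mul : d.whiteningᵀ * R * d.whitening = Matrix.diagonal d.lam := by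
  have hU : d.Uᵀ * d.U = 1 := (Matrix.mem_orthogonalGroup_iff' _ _).1 d.U_mem
  calc d.whiteningᵀ * R * d.whitening
      = d.Uᵀ * ((Matrix.diagonal (fun i => (√(d.lamBar i))⁻¹) * (colEmb m d.t)ᵀ) * d.Ubarᵀ * R *
          d.Ubar * (colEmb m d.t * Matrix.diagonal (fun i => (√(d.lamBar i))⁻¹))) * d.U := by
        simp only [whitening, Matrix.transpose_mul, Matrix.diagonal_transpose, Matrix.mul_assoc]
    _ = (d.Uᵀ * d.U) * Matrix.diagonal d.lam * (d.Uᵀ * d.U) := by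
        rw [d.T_eq]
        simp only [Matrix.mul_assoc]
    _ = Matrix.diagonal d.lam := by rw [hU, Matrix.one_mul, Matrix.mul_one]

lemma mul_whitening : D * d.whitening = d.coloring := by
  have h : d.coloringᵀ * d.whitening = 1 := by
    rw [← Matrix.transpose_transpose d.whitening, ← Matrix.transpose_mul,
      whitening_transpose_mul_coloring, Matrix.transpose_one]
  calc D * d.whitening = d.coloring * d.coloringᵀ * d.whitening := by
        rw [coloring_mul_transpose]
    _ = d.coloring := by rw [Matrix.mul_assoc, h, Matrix.mul_one]

lemma whitening_transpose_mul_mul_self : d.whiteningᵀ * D * d.whitening = 1 := by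
  rw [Matrix.mul_assoc, mul_whitening, whitening_transpose_mul_coloring]

lemma lam_mem_Icc (hR : R.PosSemidef) (hDR : (D - R).PosSemidef) (i : Fin d.t) :
    d.lam i ∈ Set.Icc (0 : ℝ) 1 := by
  have h_nonneg : (Matrix.diagonal d.lam).PosSemidef := by
    rw [← d.whitening_transpose_mul_mul, ← Matrix.conjTranspose_eq_transpose_of_trivial]
    exact hR.conjTranspose_mul_mul_same _
  have h_le_one : (1 - Matrix.diagonal d.lam).PosSemidef := by
    rw [← d.whitening_transpose_mul_mul, ← d.whitening_transpose_mul_mul_self, ← Matrix.sub_mul,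
      ← Matrix.mul_sub, ← Matrix.conjTranspose_eq_transpose_of_trivial]
    exact hDR.conjTranspose_mul_mul_same _
  exact ⟨by simpa using h_nonneg.diag_nonneg (i := i),
    by simpa using h_le_one.diag_nonneg (i := i)⟩

lemma exists_isWeights (h : ∀ i, d.lam i ∈ Set.Icc (0 : ℝ) 1) :
    ∃ a b : Fin d.t → ℝ, d.IsWeights a b := by
  refine ⟨fun i => √(d.lam i), fun i => √(1 - d.lam i), fun i => ?_⟩
  simp [Real.sq_sqrt (h i).1, Real.sq_sqrt (sub_nonneg.2 (h i).2)]

lemma posSemidef_noise (b : Fin d.t → ℝ) : (d.noise b).PosSemidef := by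
  rw [noise, ← Matrix.conjTranspose_eq_transpose_of_trivial]
  exact (Matrix.PosSemidef.diagonal fun i => sq_nonneg (b i)).mul_mul_conjTranspose_same _

variable (a b : Fin d.t → ℝ)

lemma gain_eq : d.gain a = d.whitening * Matrix.diagonal a * (colEmb m d.t)ᵀ := by
  simp only [gain, whitening, Matrix.mul_assoc]

lemma mul_gain : D * d.gain a = d.coloring * Matrix.diagonal a * (colEmb m d.t)ᵀ := by
  rw [gain_eq, Matrix.mul_assoc, ← Matrix.mul_assoc, mul_whitening, Matrix.mul_assoc]

lemma transpose_gain_mul_coloring :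
    (d.gain a)ᵀ * d.coloring = colEmb m d.t * Matrix.diagonal a := by
  rw [gain_eq, Matrix.transpose_mul, Matrix.transpose_mul, Matrix.transpose_transpose,
    Matrix.diagonal_transpose, Matrix.mul_assoc, Matrix.mul_assoc,
    whitening_transpose_mul_coloring, Matrix.mul_one]

lemma transpose_gain_mul_mul_gain_add_noise :
    (d.gain a)ᵀ * D * d.gain a + d.noise b =
      colEmb m d.t * Matrix.diagonal (fun i => a i ^ 2 + b i ^ 2) * (colEmb m d.t)ᵀ := by
  have h_signal : (d.gain a)ᵀ * D * d.gain a =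
      colEmb m d.t * Matrix.diagonal (fun i => a i ^ 2) * (colEmb m d.t)ᵀ := by
    rw [Matrix.mul_assoc, mul_gain, ← Matrix.mul_assoc, ← Matrix.mul_assoc,
      transpose_gain_mul_coloring, Matrix.mul_assoc (colEmb m d.t), Matrix.diagonal_mul_diagonal]
    simp only [sq]
  rw [h_signal, noise, ← Matrix.add_mul, ← Matrix.mul_add, Matrix.diagonal_add]

/-- The Kalman gain for estimating a vector of covariance `D` from the signal with gain
`d.gain a` and noise covariance `d.noise b`. -/
def kalmanGain : Matrix (Fin m) (Fin m) ℝ :=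
  d.coloring * Matrix.diagonal (fun i => a i / (a i ^ 2 + b i ^ 2)) * (colEmb m d.t)ᵀ

variable {a b}

lemma kalmanGain_mul (hab : d.IsWeights a b) :
    d.kalmanGain a b * ((d.gain a)ᵀ * D * d.gain a + d.noise b) = D * d.gain a := by
  calc d.kalmanGain a b * ((d.gain a)ᵀ * D * d.gain a + d.noise b)
      = d.coloring * (Matrix.diagonal (fun i => a i / (a i ^ 2 + b i ^ 2)) *
          ((colEmb m d.t)ᵀ * colEmb m d.t) * Matrix.diagonal (fun i => a i ^ 2 + b i ^ 2)) *
          (colEmb m d.t)ᵀ := by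
        rw [transpose_gain_mul_mul_gain_add_noise]
        simp only [kalmanGain, Matrix.mul_assoc]
    _ = D * d.gain a := by
        simp only [colEmb_transpose_mul_colEmb d.t_le, Matrix.mul_one,
          Matrix.diagonal_mul_diagonal, div_mul_cancel₀ _ (hab _).1.ne', mul_gain]

lemma kalmanGain_mul_transpose_gain_mul (hR : R.PosSemidef) (hDR : (D - R).PosSemidef)
    (hab : d.IsWeights a b) : d.kalmanGain a b * (d.gain a)ᵀ * D = R := by
  have h_lam : ∀ i, a i / (a i ^ 2 + b i ^ 2) * a i = d.lam i := fun i => by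
    rw [← (hab i).2, sq (a i), div_mul_eq_mul_div]
  calc d.kalmanGain a b * (d.gain a)ᵀ * D
      = d.kalmanGain a b * ((d.gain a)ᵀ * d.coloring) * d.coloringᵀ := by
        rw [← Matrix.mul_assoc, Matrix.mul_assoc _ d.coloring, coloring_mul_transpose]
    _ = d.coloring * (Matrix.diagonal (fun i => a i / (a i ^ 2 + b i ^ 2)) *
          ((colEmb m d.t)ᵀ * colEmb m d.t) * Matrix.diagonal a) * d.coloringᵀ := by
        rw [transpose_gain_mul_coloring]
        simp only [kalmanGain, Matrix.mul_assoc]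
    _ = d.coloring * (d.whiteningᵀ * R * d.whitening) * d.coloringᵀ := by
        rw [colEmb_transpose_mul_colEmb d.t_le, Matrix.mul_one, Matrix.diagonal_mul_diagonal,
          whitening_transpose_mul_mul]
        simp only [h_lam]
    _ = R := mul_transpose_mul_mul_mul_transpose_of_posSemidef_sub
        d.whitening_transpose_mul_coloring hR (by rwa [coloring_mul_transpose])

end SpectralData

lemma exists_perm_iff_lt_card {m : ℕ} (p : Fin m → Prop) [DecidablePred p] :
    ∃ σ : Equiv.Perm (Fin m), ∀ i, p (σ i) ↔ (i : ℕ) < Fintype.card {i // p i} := by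
  have h_le : Fintype.card {i // p i} ≤ m :=
    (Fintype.card_subtype_le p).trans_eq (Fintype.card_fin m)
  have h_card : Fintype.card {i : Fin m // (i : ℕ) < Fintype.card {i // p i}} =
      Fintype.card {i // p i} := by
    rw [Fintype.card_subtype, Fin.card_filter_val_lt, min_eq_right h_le]
  let e := Fintype.equivOfCardEq h_card
  exact ⟨e.extendSubtype, fun i =>
    ⟨not_imp_not.1 (e.extendSubtype_not_mem i), e.extendSubtype_mem i⟩⟩

lemma exists_orthogonal_eq_mul_diagonal_mul_transpose {ι : Type*} [Fintype ι] [DecidableEq ι]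
    {D : Matrix ι ι ℝ} (hD : D.IsHermitian) :
    ∃ V ∈ Matrix.orthogonalGroup ι ℝ, D = V * Matrix.diagonal hD.eigenvalues * Vᵀ := by
  refine ⟨hD.eigenvectorUnitary, hD.eigenvectorUnitary.2, ?_⟩
  conv_lhs => rw [hD.spectral_theorem, Unitary.conjStarAlgAut_apply]
  rfl

lemma exists_eq_mul_colEmb_diagonal_mul_transpose {m : ℕ} {D : Matrix (Fin m) (Fin m) ℝ}
    (hD : D.PosSemidef) :
    ∃ (V : Matrix (Fin m) (Fin m) ℝ) (l : Fin D.rank → ℝ),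
      V ∈ Matrix.orthogonalGroup (Fin m) ℝ ∧ (∀ i, 0 < l i) ∧
      D = V * (colEmb m D.rank * Matrix.diagonal l * (colEmb m D.rank)ᵀ) * Vᵀ := by
  have hH := hD.isHermitian
  obtain ⟨W, hW, hDW⟩ := exists_orthogonal_eq_mul_diagonal_mul_transpose hH
  obtain ⟨σ, hσ⟩ := exists_perm_iff_lt_card fun i => hH.eigenvalues i ≠ 0
  rw [← hH.rank_eq_card_non_zero_eigs] at hσ
  refine ⟨W.submatrix id σ, fun i => hH.eigenvalues (σ (Fin.castLE D.rank_le_width i)), ?_,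
    fun i => (hD.eigenvalues_nonneg _).lt_of_ne' ((hσ _).2 i.2), ?_⟩
  · rw [Matrix.mem_orthogonalGroup_iff', Matrix.transpose_submatrix,
      ← Matrix.submatrix_mul _ _ _ _ _ Function.bijective_id,
      (Matrix.mem_orthogonalGroup_iff' _ _).1 hW, Matrix.submatrix_one_equiv]
  · rw [colEmb_mul_diagonal_castLE_mul_transpose D.rank_le_width
      (f := fun i => hH.eigenvalues (σ i)) fun i hi => not_not.1 (mt (hσ i).1 hi.not_gt),
      ← Function.comp_def hH.eigenvalues, ← Matrix.submatrix_diagonal_equiv,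
      Matrix.transpose_submatrix, Matrix.submatrix_mul_equiv, Matrix.submatrix_mul_equiv, ← hDW,
      Matrix.submatrix_id_id]

lemma nonempty_spectralData {m : ℕ} {D R : Matrix (Fin m) (Fin m) ℝ} (hD : D.PosSemidef)
    (hR : R.IsHermitian) : Nonempty (SpectralData D R) := by
  obtain ⟨V, l, hV, hl, hDV⟩ := exists_eq_mul_colEmb_diagonal_mul_transpose hD
  let N : Matrix (Fin D.rank) (Fin D.rank) ℝ := Matrix.diagonal fun i => (√(l i))⁻¹
  have hT : (N * (colEmb m D.rank)ᵀ * Vᵀ * R * V * (colEmb m D.rank * N)).IsHermitian := by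
    convert Matrix.isHermitian_conjTranspose_mul_mul (V * (colEmb m D.rank * N)) hR using 1
    simp [N, Matrix.conjTranspose_eq_transpose_of_trivial, Matrix.transpose_mul, Matrix.mul_assoc]
  obtain ⟨U, hU, hTU⟩ := exists_orthogonal_eq_mul_diagonal_mul_transpose hT
  exact ⟨⟨D.rank, rfl, V, l, U, hT.eigenvalues, hV, hl, hDV, hU, hTU⟩⟩

/-- The contribution `x_k - x_k^o` of the control inputs to the state, as a function of the signals
received before stage `k`. -/
def Plant.controlEffect {m r : ℕ} (P : Plant m r) (γ : ControlPolicy m r) :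
    (k : ℕ) → (Fin k → Vec m) → Vec m
  | 0, _ => 0
  | k + 1, s => matVec P.A (P.controlEffect γ k (Fin.init s)) + matVec P.B (γ.act k s)

lemma Plant.measurable_controlEffect {m r : ℕ} (P : Plant m r) (γ : ControlPolicy m r) (k : ℕ) :
    Measurable (P.controlEffect γ k) := by
  induction k with
  | zero => exact measurable_const
  | succ k ih =>
    have h_init : Measurable (Fin.init : (Fin (k + 1) → Vec m) → Fin k → Vec m) :=
      measurable_pi_lambda _ fun j => measurable_pi_apply j.castSucc
    have h_act := γ.measurable_act k
    exact ((measurable_matVec P.A).comp (ih.comp h_init)).add ((measurable_matVec P.B).comp h_act)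

namespace ClosedLoop

variable {m r : ℕ} {P : Plant m r} {κ : ℕ} {η : SignalingRule m} {γ : ControlPolicy m r}
  {Ω : Type u} {M : MeasurableSpace Ω} [mΩ : MeasurableSpace Ω] {μ : Measure Ω}
  (c : ClosedLoop P κ η γ μ) {k n : ℕ}

/-- The tuple of the first `n` signals; `signalAlgebra k` is generated by `signals (k + 1)`. -/
def signals (n : ℕ) (ω : Ω) : Fin n → Vec m := fun j => c.s j ω

/-- The independent Gaussian vectors that drive the system. -/
abbrev sources : Unit ⊕ (Fin κ ⊕ Fin κ) → Ω → Vec m :=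
  Sum.elim (fun _ => c.x 0) (Sum.elim (fun k => c.w k) (fun k => c.v k))

lemma measurable_signals (hn : n ≤ κ) : Measurable (c.signals n) :=
  measurable_pi_lambda _ fun j => c.measurable_s j (j.2.trans_le hn)

lemma measurable_sources (i : Unit ⊕ (Fin κ ⊕ Fin κ)) : Measurable (c.sources i) := by
  rcases i with _ | k | k
  · exact c.measurable_init
  · exact c.measurable_w k k.2
  · exact c.measurable_v k k.2

lemma measurable_free (h_init : Measurable[M] (c.x 0)) (hw : ∀ j < k, Measurable[M] (c.w j)) :
    Measurable[M] (c.free k) := by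
  induction k with
  | zero => exact h_init
  | succ k ih =>
    exact ((measurable_matVec P.A).comp (ih fun j hj => hw j (hj.trans k.lt_succ_self))).add
      (hw k k.lt_succ_self)

lemma signalAlgebra_le (hk : k < κ) : c.signalAlgebra k ≤ mΩ :=
  (c.measurable_signals hk).comap_le

lemma signalAlgebra_mono : c.signalAlgebra k ≤ c.signalAlgebra (k + 1) := by
  have h_init : Measurable (Fin.init : (Fin (k + 2) → Vec m) → Fin (k + 1) → Vec m) :=
    measurable_pi_lambda _ fun j => measurable_pi_apply j.castSucc
  exact (h_init.comp (comap_measurable (c.signals (k + 2)))).comap_le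

lemma state_ae_eq (hk : k ≤ κ) :
    c.x k =ᵐ[μ] fun ω => c.free k ω + P.controlEffect γ k (c.signals k ω) := by
  induction k with
  | zero => exact .of_forall fun ω => (add_zero _).symm
  | succ k ih =>
    filter_upwards [ih (Nat.le_of_succ_le hk), c.state_eq k hk, c.control_eq k hk]
      with ω h_state h_step h_control
    calc c.x (k + 1) ω
      _ = matVec P.A (c.free k ω) + matVec P.A (P.controlEffect γ k (c.signals k ω)) +
          matVec P.B (γ.act k (c.signals (k + 1) ω)) + c.w k ω := by
        rw [h_step, h_state, h_control, matVec_add]; rfl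
      _ = c.free (k + 1) ω + P.controlEffect γ (k + 1) (c.signals (k + 1) ω) := by
        rw [add_assoc (matVec P.A _), add_right_comm]; rfl

lemma signal_ae_eq (hk : k < κ) :
    c.s k =ᵐ[μ] fun ω => ∑ j ∈ Finset.range (k + 1), matVec (η.gain k j)ᵀ
      (c.free j ω + P.controlEffect γ j (c.signals j ω)) + c.v k ω := by
  have h_state : ∀ᵐ ω ∂μ, ∀ j ∈ Finset.range (k + 1),
      c.x j ω = c.free j ω + P.controlEffect γ j (c.signals j ω) :=
    (Finset.eventually_all _).2 fun j hj =>
      c.state_ae_eq ((Nat.lt_succ_iff.1 (Finset.mem_range.1 hj)).trans hk.le)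
  filter_upwards [c.signal_eq k hk, h_state] with ω h_signal h_state
  rw [h_signal, Finset.sum_congr rfl fun j hj => by rw [h_state j hj]]

lemma signal_ae_eq_of_isMemoryless (hη : η.IsMemoryless κ) (hk : k < κ) :
    c.s k =ᵐ[μ] fun ω => matVec (η.gain k k)ᵀ (c.free k ω) +
      matVec (η.gain k k)ᵀ (P.controlEffect γ k (c.signals k ω)) + c.v k ω := by
  filter_upwards [c.signal_ae_eq hk] with ω h_signal
  rw [h_signal, Finset.sum_range_succ, Finset.sum_eq_zero, zero_add, matVec_add]
  intro j hj
  rw [hη k hk j (Finset.mem_range.1 hj), Matrix.transpose_zero, zero_matVec]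

lemma aestronglyMeasurable_signals (hn : n ≤ κ)
    (h_free : ∀ k < n, AEStronglyMeasurable[M] (c.free k) μ)
    (hv : ∀ k < n, AEStronglyMeasurable[M] (c.v k) μ) :
    AEStronglyMeasurable[M] (c.signals n) μ := by
  suffices h : ∀ k < n, AEStronglyMeasurable[M] (c.s k) μ from
    aestronglyMeasurable_pi fun j => h j j.2
  intro k hk
  induction k using Nat.strong_induction_on with
  | _ k ih =>
    refine AEStronglyMeasurable.congr ?_ (c.signal_ae_eq (hk.trans_le hn)).symm
    refine AEStronglyMeasurable.add ?_ (hv k hk)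
    rw [← Finset.sum_fn]
    refine Finset.sum_induction _ (AEStronglyMeasurable[M] · μ) (fun _ _ => .add)
      aestronglyMeasurable_const fun j hj => ?_
    have hjk : j ≤ k := Nat.lt_succ_iff.1 (Finset.mem_range.1 hj)
    have h_signals : AEStronglyMeasurable[M] (c.signals j) μ :=
      aestronglyMeasurable_pi fun i => ih i (i.2.trans_le hjk) ((i.2.trans_le hjk).trans hk)
    exact (continuous_matVec _).comp_aestronglyMeasurable
      ((h_free j (hjk.trans_lt hk)).add
        (aestronglyMeasurable_measurable_comp (P.measurable_controlEffect γ j) h_signals))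

lemma indepFun_free_signals_source (e : Unit ⊕ (Fin κ ⊕ Fin κ)) (hn : n ≤ κ) (hk : k ≤ κ)
    (hnk : n ≤ k + 1) (h_init : .inl () ≠ e) (hw : ∀ j : Fin κ, j < k → .inr (.inl j) ≠ e)
    (hv : ∀ j : Fin κ, j < n → .inr (.inr j) ≠ e) :
    IndepFun (fun ω => (c.free k ω, c.signals n ω)) (c.sources e) μ := by
  let F : Unit ⊕ (Fin κ ⊕ Fin κ) → MeasurableSpace Ω := fun i =>
    MeasurableSpace.comap (c.sources i) inferInstance
  have h_indep : Indep (⨆ i ∈ ({e} : Set _), F i) (⨆ i ∈ ({e}ᶜ : Set _), F i) μ :=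
    indep_iSup_of_disjoint (fun i => (c.measurable_sources i).comap_le) c.indep
      disjoint_compl_right
  rw [iSup_singleton] at h_indep
  have h_source : ∀ i, i ≠ e → Measurable[⨆ i ∈ ({e}ᶜ : Set _), F i] (c.sources i) :=
    fun i hi => measurable_iff_comap_le.2
      (le_iSup₂ (f := fun i (_ : i ∈ ({e}ᶜ : Set _)) => F i) i hi)
  have h_free : ∀ j ≤ k, Measurable[⨆ i ∈ ({e}ᶜ : Set _), F i] (c.free j) := fun j hj =>
    c.measurable_free (h_source _ h_init) fun i hi =>
      h_source (.inr (.inl ⟨i, (hi.trans_le hj).trans_le hk⟩)) (hw _ (hi.trans_le hj))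
  refine (indepFun_of_aestronglyMeasurable h_indep (.prodMk ?_ ?_)).symm
  · exact (h_free k le_rfl).stronglyMeasurable.aestronglyMeasurable
  · refine c.aestronglyMeasurable_signals hn (fun j hj => ?_) fun j hj => ?_
    · exact (h_free j (by lia)).stronglyMeasurable.aestronglyMeasurable
    · exact (h_source (.inr (.inr ⟨j, hj.trans_le hn⟩))
        (hv _ hj)).stronglyMeasurable.aestronglyMeasurable

lemma indepFun_free_signals_w (hk : k < κ) :
    IndepFun (fun ω => (c.free k ω, c.signals (k + 1) ω)) (c.w k) μ :=
  c.indepFun_free_signals_source (.inr (.inl ⟨k, hk⟩)) hk hk.le le_rfl Sum.inl_ne_inr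
    (fun j hj => by simpa [Fin.ext_iff] using hj.ne) fun j _ => by simp

lemma indepFun_free_signals_v (hk : k < κ) :
    IndepFun (fun ω => (c.free k ω, c.signals k ω)) (c.v k) μ :=
  c.indepFun_free_signals_source (.inr (.inr ⟨k, hk⟩)) hk.le hk.le k.le_succ Sum.inl_ne_inr
    (fun j _ => by simp) fun j hj => by simpa [Fin.ext_iff] using hj.ne

lemma isCenteredGaussian_w (hk : k < κ) : IsCenteredGaussian (c.w k) P.stepCov μ :=
  .of_hasLaw P.stepCov_psd (c.w_law k hk)

lemma isCenteredGaussian_v (hk : k < κ) : IsCenteredGaussian (c.v k) (η.noiseCov k) μ :=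
  .of_hasLaw (η.noiseCov_psd k) (c.v_law k hk)

lemma isCenteredGaussian_free (hk : k ≤ κ) : IsCenteredGaussian (c.free k) (P.freeCov k) μ := by
  induction k with
  | zero => exact .of_hasLaw P.initCov_psd c.init_law
  | succ k ih =>
    exact ((ih (Nat.le_of_succ_le hk)).matVec P.A).add (c.isCenteredGaussian_w hk)
      ((c.indepFun_free_signals_w hk).comp ((measurable_matVec P.A).comp measurable_fst)
        measurable_id)

section Necessity

variable [IsProbabilityMeasure μ]

lemma condExp_free_succ (hk : k < κ) :
    μ[c.free (k + 1) | c.signalAlgebra k] =ᵐ[μ]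
      fun ω => matVec P.A ((μ[c.free k | c.signalAlgebra k]) ω) := by
  have h_free := c.isCenteredGaussian_free hk.le
  have hw := c.isCenteredGaussian_w hk
  have h_add := condExp_add (h_free.matVec P.A).integrable hw.integrable (c.signalAlgebra k)
  have h_A := (matVecCLM P.A).comp_condExp_comm (m := c.signalAlgebra k) h_free.integrable
  have h_w : μ[c.w k | c.signalAlgebra k] =ᵐ[μ] fun _ => ∫ ω, c.w k ω ∂μ :=
    condExp_comap_of_indepFun (c.measurable_w k hk) (c.measurable_signals hk)
      ((c.indepFun_free_signals_w hk).comp measurable_snd measurable_id).symm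
  refine Filter.EventuallyEq.trans h_add ?_
  filter_upwards [h_w, h_A] with ω h_w h_A
  rw [Pi.add_apply, h_w, hw.integral_eq_zero, add_zero]
  exact h_A.symm

lemma covMatrix_condExp_free_succ (hk : k < κ) :
    covMatrix μ (μ[c.free (k + 1) | c.signalAlgebra k]) = P.A * c.posteriorCov k * P.Aᵀ := by
  rw [covMatrix_congr (c.condExp_free_succ hk),
    covMatrix_matVec ((c.isCenteredGaussian_free hk.le).memLp.condExp one_le_two), posteriorCov]

theorem satisfiesLMI_posteriorCov : P.SatisfiesLMI κ c.posteriorCov := by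
  have h_upper : ∀ k < κ, (P.freeCov k - c.posteriorCov k).PosSemidef := fun k hk => by
    have h_free := c.isCenteredGaussian_free hk.le
    rw [← h_free.covMatrix_eq]
    exact posSemidef_covMatrix_sub_condExp (c.signalAlgebra_le hk) h_free.memLp
  refine ⟨fun hκ => ⟨h_upper 0 hκ, ?_⟩, fun k hk => ⟨h_upper _ hk, ?_⟩⟩
  · exact posSemidef_covMatrix ((c.isCenteredGaussian_free hκ.le).memLp.condExp one_le_two)
  · rw [← c.covMatrix_condExp_free_succ (Nat.lt_of_succ_lt hk)]
    exact posSemidef_covMatrix_condExp_sub_condExp c.signalAlgebra_mono (c.signalAlgebra_le hk)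
      (c.isCenteredGaussian_free hk.le).memLp

end Necessity

end ClosedLoop

namespace Plant.SatisfiesLMI

variable {m r : ℕ} {P : Plant m r} {κ k : ℕ} {S : ℕ → Matrix (Fin m) (Fin m) ℝ}

lemma posSemidef_freeCov_sub (h : P.SatisfiesLMI κ S) (hk : k < κ) :
    (P.freeCov k - S k).PosSemidef := by
  cases k with
  | zero => exact (h.1 hk).1
  | succ k => exact (h.2 k hk).1

lemma posSemidef_sub_predCov (h : P.SatisfiesLMI κ S) (hk : k < κ) :
    (S k - P.predCov S k).PosSemidef := by
  cases k with
  | zero => simpa only [predCov, sub_zero] using (h.1 hk).2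
  | succ k => exact (h.2 k hk).2

lemma posSemidef_sub_sub (h : P.SatisfiesLMI κ S) (hk : k < κ) :
    (P.freeCov k - P.predCov S k - (S k - P.predCov S k)).PosSemidef := by
  rw [sub_sub_sub_cancel_right]
  exact h.posSemidef_freeCov_sub hk

lemma posSemidef_freeCov_sub_predCov (h : P.SatisfiesLMI κ S) (hk : k < κ) :
    (P.freeCov k - P.predCov S k).PosSemidef := by
  simpa only [sub_add_sub_cancel] using
    (h.posSemidef_freeCov_sub hk).add (h.posSemidef_sub_predCov hk)

lemma nonempty_stageData (h : P.SatisfiesLMI κ S) (hk : k < κ) : Nonempty (StageData P S k) :=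
  nonempty_spectralData (h.posSemidef_freeCov_sub_predCov hk)
    (h.posSemidef_sub_predCov hk).isHermitian

lemma lam_mem_Icc (h : P.SatisfiesLMI κ S) (hk : k < κ) (d : StageData P S k) (i : Fin d.t) :
    d.lam i ∈ Set.Icc (0 : ℝ) 1 :=
  d.lam_mem_Icc (h.posSemidef_sub_predCov hk) (h.posSemidef_sub_sub hk) i

lemma exists_isSpectralRule (h : P.SatisfiesLMI κ S) :
    ∃ η : SignalingRule m, IsSpectralRule P κ S η := by
  have h_stage : ∀ k, ∃ G N : Matrix (Fin m) (Fin m) ℝ, N.PosSemidef ∧ (k < κ →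
      ∃ (d : StageData P S k) (a b : Fin d.t → ℝ), d.IsWeights a b ∧ G = d.gain a ∧
        N = d.noise b) := fun k => by
    by_cases hk : k < κ
    · obtain ⟨d⟩ := h.nonempty_stageData hk
      obtain ⟨a, b, hab⟩ := d.exists_isWeights (h.lam_mem_Icc hk d)
      exact ⟨d.gain a, d.noise b, d.posSemidef_noise b, fun _ => ⟨d, a, b, hab, rfl, rfl⟩⟩
    · exact ⟨0, 0, .zero, fun hk' => absurd hk' hk⟩
  choose G N hN hGN using h_stage
  refine ⟨⟨fun k j => if j = k then G k else 0, N, hN⟩, fun k _ j hj => if_neg hj.ne,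
    fun k hk => ?_⟩
  simpa only [if_true] using hGN k hk

end Plant.SatisfiesLMI

namespace IsSpectralRule

variable {m r : ℕ} {P : Plant m r} {κ k : ℕ} {η : SignalingRule m} {γ : ControlPolicy m r}
  {S : ℕ → Matrix (Fin m) (Fin m) ℝ} {Ω : Type u} [MeasurableSpace Ω] {μ : Measure Ω}
  {f : (Fin k → Vec m) → Vec m}

lemma isGaussianEstimate_update (hη : IsSpectralRule P κ S η) (hS : P.SatisfiesLMI κ S)
    (c : ClosedLoop P κ η γ μ) (hk : k < κ)
    (h : IsGaussianEstimate (c.free k) (c.signals k) f (P.freeCov k - P.predCov S k) μ) :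
    ∃ f', IsGaussianEstimate (c.free k) (c.signals (k + 1)) f' (P.freeCov k - S k) μ := by
  obtain ⟨d, a, b, hab, h_gain, h_noise⟩ := hη.2 k hk
  let K := d.kalmanGain a b
  have hK : K * ((η.gain k k)ᵀ * (P.freeCov k - P.predCov S k) * (η.gain k k)ᵀᵀ +
      η.noiseCov k) = (P.freeCov k - P.predCov S k) * (η.gain k k)ᵀᵀ := by
    rw [Matrix.transpose_transpose, h_gain, h_noise, d.kalmanGain_mul hab]
  have h_reduction : K * (η.gain k k)ᵀ * (P.freeCov k - P.predCov S k) = S k - P.predCov S k := by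
    rw [h_gain, d.kalmanGain_mul_transpose_gain_mul (hS.posSemidef_sub_predCov hk)
      (hS.posSemidef_sub_sub hk) hab]
  have h_update := h.update (c.measurable_signals hk.le).aemeasurable (c.isCenteredGaussian_v hk)
    (c.indepFun_free_signals_v hk)
    ((measurable_matVec (η.gain k k)ᵀ).comp (P.measurable_controlEffect γ k))
    (c.signal_ae_eq_of_isMemoryless hη.1 hk) hK
  rw [h_reduction, sub_sub_sub_cancel_right] at h_update
  let snoc := (MeasurableEquiv.piFinSuccAbove (fun _ => Vec m) (Fin.last k)).symm
  have h_signals : c.signals (k + 1) = fun ω => snoc (c.s k ω, c.signals k ω) := by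
    funext ω
    refine snoc.symm.injective ?_
    rw [MeasurableEquiv.symm_apply_apply]
    exact Prod.ext rfl (funext fun j =>
      congrArg (fun i : Fin (k + 1) => c.s i ω) (Fin.succAbove_last_apply j))
  rw [h_signals]
  exact ⟨_, h_update.map_observation snoc⟩

lemma exists_isGaussianEstimate (hη : IsSpectralRule P κ S η) (hS : P.SatisfiesLMI κ S)
    (c : ClosedLoop P κ η γ μ) (hk : k < κ) :
    ∃ f, IsGaussianEstimate (c.free k) (c.signals (k + 1)) f (P.freeCov k - S k) μ := by
  induction k with
  | zero =>
    refine hη.isGaussianEstimate_update hS c hk (f := fun _ => 0) (.of_unique ?_)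
    simpa only [Plant.predCov, sub_zero] using c.isCenteredGaussian_free hk.le
  | succ k ih =>
    have hk' := Nat.lt_of_succ_lt hk
    obtain ⟨f, h⟩ := ih hk'
    refine hη.isGaussianEstimate_update hS c hk (f := fun y => matVec P.A (f y)) ?_
    have h_cov : P.freeCov (k + 1) - P.predCov S (k + 1) =
        P.A * (P.freeCov k - S k) * P.Aᵀ + P.stepCov := by
      rw [Plant.freeCov, Plant.predCov, Matrix.mul_sub, Matrix.sub_mul, add_sub_right_comm]
    rw [h_cov]
    exact h.predict (c.measurable_signals hk.le).aemeasurable (c.isCenteredGaussian_w hk')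
      (c.indepFun_free_signals_w hk') P.A

theorem posteriorCov_eq (hη : IsSpectralRule P κ S η) (hS : P.SatisfiesLMI κ S)
    (c : ClosedLoop P κ η γ μ) (hk : k < κ) : c.posteriorCov k = S k := by
  obtain ⟨f, h⟩ := hη.exists_isGaussianEstimate hS c hk
  have h_free := c.isCenteredGaussian_free hk.le
  have h_measurable : Measurable (c.free k) :=
    c.measurable_free c.measurable_init fun j hj => c.measurable_w j (hj.trans hk)
  calc c.posteriorCov k
    _ = covMatrix μ (c.free k) - (P.freeCov k - S k) :=
      h.covMatrix_condExp h_measurable (c.measurable_signals hk) h_free.memLp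
    _ = S k := by rw [h_free.covMatrix_eq, sub_sub_cancel]

end IsSpectralRule


end

theorem proposition1 {m r : ℕ} (P : Plant m r) (κ : ℕ) :
    -- necessity
    (∀ (η : SignalingRule m) (γ : ControlPolicy m r) {Ω : Type u} [MeasurableSpace Ω]
        (μ : Measure Ω) [IsProbabilityMeasure μ] (c : ClosedLoop P κ η γ μ),
      (∀ k < κ, MemLp (c.free k) 2 μ ∧ secondMoment μ (c.free k) = P.freeCov k) ∧
      P.SatisfiesLMI κ c.posteriorCov) ∧
    -- sufficiency
    (∀ S : ℕ → Matrix (Fin m) (Fin m) ℝ, (∀ k < κ, (S k).PosSemidef) → P.SatisfiesLMI κ S →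
      -- eigenvalues of the normalized matrices lie in `[0, 1]`, and weights exist
      (∀ k < κ, ∀ d : StageData P S k,
        (∀ i, d.lam i ∈ Set.Icc (0 : ℝ) 1) ∧ ∃ a b : Fin d.t → ℝ, d.IsWeights a b) ∧
      -- the explicit memoryless rules exist
      (∃ η : SignalingRule m, IsSpectralRule P κ S η) ∧
      -- each of them realizes `S`, whatever the control policy is
      (∀ η : SignalingRule m, IsSpectralRule P κ S η →
        ∀ (γ : ControlPolicy m r) {Ω : Type u} [MeasurableSpace Ω]
          (μ : Measure Ω) [IsProbabilityMeasure μ] (c : ClosedLoop P κ η γ μ),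
        ∀ k < κ, c.posteriorCov k = S k)) := by
  refine ⟨fun η γ Ω _ μ _ c => ⟨fun k hk => ?_, c.satisfiesLMI_posteriorCov⟩,
    fun S _ hS => ⟨fun k hk d => ?_, hS.exists_isSpectralRule,
      fun η hη γ Ω _ μ _ c k hk => hη.posteriorCov_eq hS c hk⟩⟩
  · have h_free := c.isCenteredGaussian_free hk.le
    refine ⟨h_free.memLp, ?_⟩
    rw [secondMoment_eq_covMatrix h_free.integrable h_free.integral_eq_zero, h_free.covMatrix_eq]
  · have h_lam := hS.lam_mem_Icc hk d
    exact ⟨h_lam, d.exists_isWeights h_lam⟩
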